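/- Let $\mathcal X,\mathcal Y$ be finite alphabets, let $P_{Y|X}$ be a channel (a probability distribution $P_{Y|X}(\cdot|x)$ on $\mathcal Y$ for each $x\in\mathcal X$), and let $P_Y$ be a probability distribution on $\mathcal Y$. Write $[P_{Y|X}\circ P_X](y)=\sum_x P_{Y|X}(y|x)P_X(x)$, let $\mathcal P(P_{Y|X},P_Y)$ be the set of probability distributions $P_X$ on $\mathcal X$ with $P_{Y|X}\circ P_X=P_Y$, and put $$G_{\mathsf E}(P_{Y|X},P_Y)=\min_{P_X\in\mathcal P(P_{Y|X},P_Y)}H(P_X),\qquad H(P_X)=-\sum_x P_X(x)\log P_X(x).$$ Logarithms are natural. Denote by $P_{Y|X}^n$ and $P_Y^n$ the $n$-fold (memoryless, i.i.d.) products. The exact channel resolvability rate $\overline G_{\mathsf E}(P_{Y|X},P_Y)$ is the infimum of the $R\ge 0$ for which there is a sequence of codes $P_{X^n|M_n}$, with $M_n$ uniformly distributed on $\{1,\dots,\lfloor e^{nR}\rfloor\}$, such that for every $n$ the law of the output $Y^n$ of the channel $P_{Y|X}^n$ with input $X^n$ is exactly $P_Y^n$, and $$\lim_{n\to\infty}\max_{f_n}\mathbb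 P\{X^n=f_n(M_n)\}=1,$$ where the maximum is over all functions $f_n:\{1,\dots,\lfloor e^{nR}\rfloor\}\to\mathcal X^n$. The channel $P_{Y|X}$ is called $P_Y$-non-redundant if there is exactly one probability distribution $P_X$ on $\mathcal X$ with $P_{Y|X}\circ P_X=P_Y$. Theorem. (1) If $P_{Y|X}$ is $P_Y$-non-redundant, and $P_X$ is the unique distribution that induces $P_Y$ through $P_{Y|X}$, then $$\overline G_{\mathsf E}(P_{Y|X},P_Y)=G_{\mathsf E}(P_{Y|X},P_Y)=H(P_X).$$ (2) If $P_{Y|X}$ is a full-rank channel, that is, the matrix $(P_{Y|X}(y|x))_{y,x}$ has rank $|\mathcal X|$, then $P_{Y|X}$ is $P_Y$-non-redundant for every $P_Y$ with $\mathcal P(P_{Y|X},P_Y)\neq\emptyset$. (3) Let $\mathcal X,\mathcal Y$ be finite subsets of a torsion-free abelian group (for example of $\mathbb R$), and let $P_{Y|X}$ be an additive channel, that is, $Y=X+Z$ with finitely supported noise $Z$ independent of $X$, so that $P_{Y|X}(y|x)=P_Z(y-x)$. Then $P_{Y|X}$ is a full-rank channel, and it is therefore $P_Y$-non-redundant for every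 $P_Y$ with $\mathcal P(P_{Y|X},P_Y)\neq\emptyset$. -/

import Mathlib

open Filter Topology

/-! Finite-alphabet information theory. A distribution on a finite alphabet `X` is an element of
`stdSimplex ℝ X`; a channel is a map `W : X → Y → ℝ`, where `W x y` is the probability of the
output `y` given the input `x`. Logarithms are natural. -/

namespace ExactResolvability

noncomputable section

/-- `W` is a channel: each `W x` is a probability distribution on `Y`. -/
def IsChannel {X Y : Type*} [Fintype Y] (W : X → Y → ℝ) : Prop :=
  ∀ x, W x ∈ stdSimplex ℝ Y

/-- The output distribution `y ↦ ∑ x, W(y|x) P(x)` induced by the input distribution `P`. -/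
def output {X Y : Type*} [Fintype X] (W : X → Y → ℝ) (P : X → ℝ) : Y → ℝ :=
  fun y => ∑ x, W x y * P x

/-- The product (i.i.d.) distribution `P^n`. -/
def powDist {X : Type*} (P : X → ℝ) (n : ℕ) : (Fin n → X) → ℝ :=
  fun x => ∏ i, P (x i)

/-- The memoryless extension `W^n` of a channel. -/
def powChannel {X Y : Type*} (W : X → Y → ℝ) (n : ℕ) : (Fin n → X) → (Fin n → Y) → ℝ :=
  fun x y => ∏ i, W (x i) (y i)

/-- Shannon entropy (in nats), with the convention `0 log 0 = 0`. -/
def entropy {X : Type*} [Fintype X] (P : X → ℝ) : ℝ :=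
  ∑ x, Real.negMulLog (P x)

/-- The set of input distributions that induce `Q` through `W`. -/
def inputs {X Y : Type*} [Fintype X] (W : X → Y → ℝ) (Q : Y → ℝ) : Set (X → ℝ) :=
  {P | P ∈ stdSimplex ℝ X ∧ output W P = Q}

/-- `W` is `Q`-non-redundant: exactly one input distribution induces `Q` through `W`. -/
def IsNonRedundant {X Y : Type*} [Fintype X] (W : X → Y → ℝ) (Q : Y → ℝ) : Prop :=
  ∃! P, P ∈ inputs W Q

/-- The uniform distribution on `N` messages. -/
def unif (N : ℕ) : Fin N → ℝ := fun _ => 1 / (N : ℝ)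

/-- The largest probability `max_f ℙ{X = f(M)}`, over all deterministic `f`, of guessing `X` from
`M`, where `M` is uniform on `N` messages and `X` has conditional distribution `K m` given
`M = m`. The maximum is over a finite set of functions. -/
def guessProb {X : Type*} {N : ℕ} (K : Fin N → X → ℝ) : ℝ :=
  ⨆ f : Fin N → X, ∑ m, unif N m * K m (f m)

/-- The number of messages `⌊e^{nR}⌋` at rate `R` and blocklength `n`. -/
def numMsg (R : ℝ) (n : ℕ) : ℕ := ⌊Real.exp (n * R)⌋₊

/-- The rate `R` is achievable for exact resolvability of the target `Q` through `W`: there are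
codes `K n = P_{X^n|M_n}`, one for each blocklength, with `M_n` uniform on `⌊e^{nR}⌋` messages,
such that the channel output has law exactly `Q^n` for each `n`, and `X^n` is an asymptotic
function of `M_n`. (The case `n = 0` imposes nothing.) -/
def Achievable {X Y : Type*} [Fintype X] (W : X → Y → ℝ) (Q : Y → ℝ) (R : ℝ) : Prop :=
  0 ≤ R ∧ ∃ K : (n : ℕ) → Fin (numMsg R n) → (Fin n → X) → ℝ,
    (∀ n, IsChannel (K n)) ∧
    (∀ n, output (powChannel W n) (output (K n) (unif (numMsg R n))) = powDist Q n) ∧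
    Tendsto (fun n => guessProb (K n)) atTop (𝓝 1)

/-- The exact channel resolvability rate: the infimum of the achievable rates (taken in the
extended reals, so that it is `⊤` if no rate is achievable). -/
def exactRate {X Y : Type*} [Fintype X] (W : X → Y → ℝ) (Q : Y → ℝ) : EReal :=
  ⨅ R ∈ {R : ℝ | Achievable W Q R}, (R : EReal)

/-- The least entropy of an input distribution that induces `Q` through `W` (in the extended
reals, so that it is `⊤` if there is no such input distribution). -/
def minEntropy {X Y : Type*} [Fintype X] (W : X → Y → ℝ) (Q : Y → ℝ) : EReal :=
  ⨅ P ∈ inputs W Q, (entropy P : EReal)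

/-- The matrix of a channel, with rows indexed by outputs and columns by inputs. -/
def channelMatrix {X Y : Type*} (W : X → Y → ℝ) : Matrix Y X ℝ :=
  Matrix.of fun y x => W x y

/-- `W` is a full-rank channel. -/
def IsFullRank {X Y : Type*} [Fintype X] (W : X → Y → ℝ) : Prop :=
  (channelMatrix W).rank = Fintype.card X

/-- `W` is an additive channel `Y = X + Z` with noise `Z` independent of `X`: the noise has a
finitely supported law `p`, and `W(y|x) = p(y - x)`. -/
def IsAdditive {G : Type*} [AddCommGroup G] {A B : Finset G} (W : A → B → ℝ) : Prop :=
  ∃ p : G →₀ ℝ, (∀ z, 0 ≤ p z) ∧ (p.sum fun _ a => a) = 1 ∧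
    ∀ (x : A) (y : B), W x y = p ((y : G) - (x : G))

end

end ExactResolvability

namespace ExactResolvability

/-! ### Full-rank channels and additive channels -/

/-! Non-redundancy tensorizes (`eq_powDist_of_output_eq`), so every code that produces the target
exactly has input law `P^n`. The rate is then that of a source problem: how many uniform messages
make a letter string of law `P^n` almost a function of the message. By the equipartition property
the threshold is the entropy.

Above it, rounding `P^n` down to multiples of `1/N` loses little mass on typical strings, and the
leftover messages restore the law exactly (`exists_code`). Below it, a guess takes at most `N`
values, which carry vanishing probability (`guessProb_le`).

Full rank means that the channel acts injectively. For an additive channel the action is convolution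
with the noise law, and a sum attained only once by the two supports leaves a nonzero entry in the
result. -/

theorem isFullRank_iff_injective {X Y : Type*} [Fintype X] [Fintype Y] (W : X → Y → ℝ) :
    IsFullRank W ↔ Function.Injective (channelMatrix W).mulVec := by
  have h := (channelMatrix W).mulVecLin.finrank_range_add_finrank_ker
  rw [Module.finrank_fintype_fun_eq_card] at h
  change Module.finrank ℝ (channelMatrix W).mulVecLin.range = Fintype.card X ↔
    Function.Injective (channelMatrix W).mulVecLin
  rw [← LinearMap.ker_eq_bot, ← Submodule.finrank_eq_zero]
  omega

theorem IsFullRank.isNonRedundant {X Y : Type*} [Fintype X] [Fintype Y] {W : X → Y → ℝ}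
    (hW : IsFullRank W) {Q : Y → ℝ} (hQ : (inputs W Q).Nonempty) : IsNonRedundant W Q := by
  obtain ⟨P, hP⟩ := hQ
  refine ⟨P, hP, fun P' hP' => (isFullRank_iff_injective W).1 hW ?_⟩
  exact hP'.2.trans hP.2.symm

/-- Two nonempty finite subsets of a torsion-free abelian group have a sum attained only once. -/
theorem exists_uniqueAdd {G : Type*} [AddCommGroup G] [IsAddTorsionFree G] {s t : Finset G}
    (hs : s.Nonempty) (ht : t.Nonempty) : ∃ a ∈ s, ∃ b ∈ t, UniqueAdd s t a b := by
  -- Only finitely many elements matter, so the search moves to the subgroup they generate, which is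
  -- finitely generated and torsion-free and thus has `UniqueSums`.
  classical
  let H := AddSubgroup.closure ((s ∪ t : Finset G) : Set G)
  have hmem : ∀ {g}, g ∈ s ∪ t → g ∈ H := fun hg => AddSubgroup.subset_closure hg
  have hsH : ∀ {g}, g ∈ s → g ∈ H := fun hg => hmem (Finset.mem_union_left _ hg)
  have htH : ∀ {g}, g ∈ t → g ∈ H := fun hg => hmem (Finset.mem_union_right _ hg)
  have : AddGroup.FG H := (AddGroup.fg_iff_addSubgroup_fg H).2 ⟨s ∪ t, rfl⟩
  have : AddMonoid.FG H := AddGroup.fg_iff_addMonoid_fg.1 this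
  obtain ⟨a₀, ha₀⟩ := hs
  obtain ⟨b₀, hb₀⟩ := ht
  obtain ⟨a, ha, b, hb, hab⟩ := UniqueSums.uniqueAdd_of_nonempty
    (A := s.subtype (· ∈ H)) (B := t.subtype (· ∈ H))
    ⟨⟨a₀, hsH ha₀⟩, by simpa⟩ ⟨⟨b₀, htH hb₀⟩, by simpa⟩
  refine ⟨a, by simpa using ha, b, by simpa using hb, fun x y hx hy hxy => ?_⟩
  have := @hab ⟨x, hsH hx⟩ ⟨y, htH hy⟩ (by simpa) (by simpa) (Subtype.ext hxy)
  simpa [Subtype.ext_iff] using this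

theorem IsAdditive.isFullRank {G : Type*} [AddCommGroup G] [IsAddTorsionFree G] {A B : Finset G}
    {W : A → B → ℝ} (hW : IsChannel W) (hadd : IsAdditive W) : IsFullRank W := by
  classical
  obtain ⟨p, hp0, hp1, hWp⟩ := hadd
  -- Each row already has mass 1 inside `B`; noise leading outside `B` would push the total mass of
  -- `p` above 1.
  have hsupp : ∀ (x : A) (z : G), p z ≠ 0 → z + x ∈ B := by
    intro x z hz
    by_contra hB
    have h1 : ∑ y : B, p ((y : G) - x) = 1 := by
      simpa only [hWp] using (hW x).2
    have h2 : ∑ y ∈ B.image (· - (x : G)), p y = 1 := by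
      rw [Finset.sum_image (fun a _ b _ h => sub_left_injective h), ← h1]
      exact (Finset.sum_coe_sort B fun y => p (y - x)).symm
    have hz' : z ∉ B.image (· - (x : G)) := by
      simp only [Finset.mem_image, not_exists, not_and]
      rintro y hy rfl
      exact hB (by simpa using hy)
    have h3 : ∑ y ∈ insert z (B.image (· - (x : G))), p y ≤ 1 := by
      rw [← hp1, Finsupp.sum, ← Finset.sum_filter_ne_zero]
      refine Finset.sum_le_sum_of_subset_of_nonneg ?_ fun _ _ _ => hp0 _
      intro y hy
      simpa using (Finset.mem_filter.1 hy).2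
    rw [Finset.sum_insert hz', h2] at h3
    exact hz (le_antisymm (by linarith) (hp0 z))
  have hp : p.support.Nonempty := by
    rw [Finsupp.support_nonempty_iff]
    rintro rfl
    simp at hp1
  rw [isFullRank_iff_injective]
  refine (injective_iff_map_eq_zero (channelMatrix W).mulVecLin).2 fun v hv => ?_
  by_contra hne
  obtain ⟨x₀, hx₀⟩ : ∃ x, v x ≠ 0 := Function.ne_iff.1 hne
  -- At the output `b + x` of a unique sum, the convolution reduces to the single term `p b * v x`,
  -- which is nonzero.
  obtain ⟨a, ha, b, hb, hab⟩ := exists_uniqueAdd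
    (s := (Finset.univ.filter fun x => v x ≠ 0).map (Function.Embedding.subtype _))
    (by rw [Finset.map_nonempty]; exact ⟨x₀, by simpa⟩) hp
  obtain ⟨x, hx, rfl⟩ := Finset.mem_map.1 ha
  have hvx : v x ≠ 0 := (Finset.mem_filter.1 hx).2
  have hpb : p b ≠ 0 := Finsupp.mem_support_iff.1 hb
  have h0 := congrFun hv ⟨b + x, hsupp x b hpb⟩
  have hsum : ∑ x' : A, p (b + x - (x' : G)) * v x' = 0 := by
    simpa [Matrix.mulVec, dotProduct, channelMatrix, hWp] using h0
  rw [Finset.sum_eq_single x] at hsum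
  · exact (mul_ne_zero hpb hvx) (by simpa using hsum)
  · intro x' _ hx'
    by_contra hne'
    obtain ⟨h1, h2⟩ := mul_ne_zero_iff.1 hne'
    have := (hab (a := x') (b := b + x - x') (Finset.mem_map.2 ⟨x', by simpa, rfl⟩)
      (Finsupp.mem_support_iff.2 h1) (by simp [add_comm])).1
    exact hx' (Subtype.ext this)
  · simp

/-! ### Uniqueness of the input law of a product channel -/

theorem sum_output {X Y : Type*} [Fintype X] [Fintype Y] {W : X → Y → ℝ} (hW : IsChannel W)
    (v : X → ℝ) : ∑ y, output W v y = ∑ x, v x := by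
  unfold output
  rw [Finset.sum_comm]
  exact Finset.sum_congr rfl fun x _ => by rw [← Finset.sum_mul, (hW x).2, one_mul]

/-- Extends uniqueness to unnormalized vectors, such as slices of a joint law. Channels preserve
mass, so `v` has mass `c`: it vanishes if `c = 0` and can be normalized otherwise. -/
theorem eq_smul_of_output_eq {X Y : Type*} [Fintype X] [Fintype Y] {W : X → Y → ℝ}
    (hW : IsChannel W) {P : X → ℝ} {Q : Y → ℝ}
    (hP : ∀ P' ∈ inputs W Q, P' = P) (hQ : ∑ y, Q y = 1) {v : X → ℝ} (hv : ∀ x, 0 ≤ v x) {c : ℝ}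
    (h : ∀ y, output W v y = c * Q y) (x : X) : v x = c * P x := by
  have hc : ∑ x, v x = c := by
    rw [← sum_output hW, Finset.sum_congr rfl fun y _ => h y, ← Finset.mul_sum, hQ, mul_one]
  rcases eq_or_ne c 0 with rfl | hc0
  · rw [zero_mul]
    exact (Finset.sum_eq_zero_iff_of_nonneg fun x _ => hv x).1 hc x (Finset.mem_univ x)
  · have hcpos : 0 ≤ c := hc ▸ Finset.sum_nonneg fun x _ => hv x
    have := hP (fun x => c⁻¹ * v x) ⟨⟨fun x => mul_nonneg (inv_nonneg.2 hcpos) (hv x), by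
      rw [← Finset.mul_sum, hc, inv_mul_cancel₀ hc0]⟩, by
        funext y
        have hy := h y
        simp only [output] at hy ⊢
        rw [← inv_mul_cancel_left₀ hc0 (Q y), ← hy, Finset.mul_sum]
        exact Finset.sum_congr rfl fun x _ => by ring⟩
    rw [← this, mul_inv_cancel_left₀ hc0]

theorem powDist_cons {X : Type*} (P : X → ℝ) (n : ℕ) (a : X) (x : Fin n → X) :
    powDist P (n + 1) (Fin.cons a x : Fin (n + 1) → X) = P a * powDist P n x := by
  simp [powDist, Fin.prod_univ_succ]

theorem powChannel_cons {X Y : Type*} (W : X → Y → ℝ) (n : ℕ) (a : X) (x : Fin n → X) (b : Y)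
    (y : Fin n → Y) : powChannel W (n + 1) (Fin.cons a x : Fin (n + 1) → X)
      (Fin.cons b y : Fin (n + 1) → Y) = W a b * powChannel W n x y := by
  simp [powChannel, Fin.prod_univ_succ]

theorem sum_fin_succ {X : Type*} [Fintype X] (n : ℕ) (F : (Fin (n + 1) → X) → ℝ) :
    ∑ x, F x = ∑ a, ∑ x : Fin n → X, F (Fin.cons a x) := by
  rw [← (Fin.consEquiv fun _ : Fin (n + 1) => X).sum_comp, Fintype.sum_prod_type]
  rfl

theorem powDist_nonneg {X : Type*} {P : X → ℝ} (hP : ∀ x, 0 ≤ P x) (n : ℕ) (x : Fin n → X) :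
    0 ≤ powDist P n x :=
  Finset.prod_nonneg fun i _ => hP (x i)

theorem sum_powDist {X : Type*} [Fintype X] {P : X → ℝ} (hP : ∑ x, P x = 1) (n : ℕ) :
    ∑ x, powDist P n x = 1 := by
  simp only [powDist]
  rw [← Fintype.sum_pow, hP, one_pow]

theorem powDist_mem_stdSimplex {X : Type*} [Fintype X] {P : X → ℝ} (hP : P ∈ stdSimplex ℝ X)
    (n : ℕ) : powDist P n ∈ stdSimplex ℝ (Fin n → X) :=
  ⟨powDist_nonneg hP.1 n, sum_powDist hP.2 n⟩

theorem isChannel_powChannel {X Y : Type*} [Fintype Y] {W : X → Y → ℝ}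
    (hW : IsChannel W) (n : ℕ) : IsChannel (powChannel W n) := by
  classical
  refine fun x => ⟨fun y => Finset.prod_nonneg fun i _ => (hW (x i)).1 _, ?_⟩
  simp only [powChannel]
  rw [← Fintype.prod_sum]
  exact Finset.prod_eq_one fun i _ => (hW (x i)).2

theorem output_powDist {X Y : Type*} [Fintype X] {W : X → Y → ℝ} {P : X → ℝ}
    {Q : Y → ℝ} (h : output W P = Q) (n : ℕ) :
    output (powChannel W n) (powDist P n) = powDist Q n := by
  classical
  subst h
  funext y
  simp only [output, powChannel, powDist, ← Finset.prod_mul_distrib]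
  rw [← Fintype.prod_sum fun i x => W x (y i) * P x]

/-- Non-redundancy passes to memoryless extensions. -/
theorem eq_powDist_of_output_eq {X Y : Type*} [Fintype X] [Fintype Y] {W : X → Y → ℝ}
    (hW : IsChannel W) {P : X → ℝ} {Q : Y → ℝ}
    (hP : ∀ P' ∈ inputs W Q, P' = P) (hQ : Q ∈ stdSimplex ℝ Y) (n : ℕ) :
    ∀ P' ∈ inputs (powChannel W n) (powDist Q n), P' = powDist P n := by
  induction n with
  | zero =>
    rintro P' ⟨⟨-, h1⟩, -⟩
    funext x
    rw [Fintype.sum_eq_single x fun y hy => (hy (Subsingleton.elim y x)).elim] at h1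
    simp [h1, powDist]
  | succ n ih =>
    rintro P' ⟨⟨h0, h1⟩, h⟩
    -- the law of the first letter jointly with the remaining outputs
    have key : ∀ (y : Fin n → Y) (a : X),
        ∑ x : Fin n → X, powChannel W n x y * P' (Fin.cons a x) = powDist Q n y * P a := by
      intro y
      refine eq_smul_of_output_eq hW hP hQ.2 (v := fun a => ∑ x : Fin n → X,
        powChannel W n x y * P' (Fin.cons a x)) (fun a => Finset.sum_nonneg fun x _ =>
          mul_nonneg ((isChannel_powChannel hW n x).1 y) (h0 _)) fun b => ?_
      have := congrFun h (Fin.cons b y : Fin (n + 1) → Y)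
      rw [powDist_cons, output, sum_fin_succ] at this
      rw [mul_comm, ← this, output]
      refine Finset.sum_congr rfl fun a _ => ?_
      rw [Finset.mul_sum]
      exact Finset.sum_congr rfl fun x _ => by rw [powChannel_cons, mul_assoc]
    -- With the first letter fixed, `key` gives the output of the remaining slice as a multiple of
    -- `Q^n`, so the scaled induction hypothesis applies.
    funext x
    rw [← Fin.cons_self_tail x, powDist_cons]
    exact eq_smul_of_output_eq (isChannel_powChannel hW n) ih (sum_powDist hQ.2 n)
      (v := fun z => P' (Fin.cons (x 0) z)) (fun _ => h0 _)
      (fun y => (key y (x 0)).trans (mul_comm _ _)) (Fin.tail x)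

theorem output_mem_stdSimplex {X Y : Type*} [Fintype X] [Fintype Y] {W : X → Y → ℝ}
    (hW : IsChannel W) {P : X → ℝ} (hP : P ∈ stdSimplex ℝ X) : output W P ∈ stdSimplex ℝ Y :=
  ⟨fun y => Finset.sum_nonneg fun x _ => mul_nonneg ((hW x).1 y) (hP.1 x),
    (sum_output hW P).trans hP.2⟩

/-! ### The asymptotic equipartition property -/

/-- A Chernoff bound in qualitative form. -/
theorem exists_sum_mul_exp_lt_one {X : Type*} [Fintype X] {P : X → ℝ} (hP : ∑ x, P x = 1)
    {g : X → ℝ} (hg : ∑ x, P x * g x < 0) : ∃ t > 0, ∑ x, P x * Real.exp (t * g x) < 1 := by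
  -- The sum is 1 at `t = 0` with negative derivative there, so it is below 1 for some small `t >
  -- 0`.
  have hd : HasDerivAt (fun t : ℝ => ∑ x, P x * Real.exp (t * g x)) (∑ x, P x * g x) 0 := by
    refine HasDerivAt.fun_sum fun x _ => ?_
    have := (((hasDerivAt_id (0 : ℝ)).mul_const (g x)).exp).const_mul (P x)
    simpa using this
  have h := hd.hasDerivWithinAt (s := Set.Ioi 0)
  rw [hasDerivWithinAt_iff_tendsto_slope' (by simp)] at h
  have hev := (h.eventually (gt_mem_nhds hg)).and self_mem_nhdsWithin
  obtain ⟨t, ht, ht0⟩ := hev.exists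
  refine ⟨t, ht0, ?_⟩
  rw [slope_def_field, div_neg_iff] at ht
  have ht0' : (0 : ℝ) < t := ht0
  rcases ht with ht | ht
  · linarith [ht.2]
  · have := ht.1
    simp only [zero_mul, Real.exp_zero, mul_one, hP] at this
    linarith

/-- Exponential Markov inequality: the mass is at most the `n`-th power of a number below 1. Strings
of probability zero are exempt from `hs` because there `Real.log` takes its default value. -/
theorem tendsto_sum_powDist_of_neg_mean {X : Type*} [Fintype X] {P : X → ℝ}
    (hP : P ∈ stdSimplex ℝ X) {g : X → ℝ} (hg : ∑ x, P x * g x < 0)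
    (s : (n : ℕ) → Finset (Fin n → X))
    (hs : ∀ n, ∀ x ∈ s n, 0 < powDist P n x → 0 ≤ ∑ i, g (x i)) :
    Tendsto (fun n => ∑ x ∈ s n, powDist P n x) atTop (𝓝 0) := by
  obtain ⟨t, ht, hlt⟩ := exists_sum_mul_exp_lt_one hP.2 hg
  refine squeeze_zero (fun n => Finset.sum_nonneg fun x _ => powDist_nonneg hP.1 n x)
    (fun n => ?_) (tendsto_pow_atTop_nhds_zero_of_lt_one
      (Finset.sum_nonneg fun x _ => mul_nonneg (hP.1 x) (Real.exp_pos _).le) hlt)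
  rw [Fintype.sum_pow]
  refine (Finset.sum_le_sum fun x hx => ?_).trans (Finset.sum_le_univ_sum_of_nonneg fun x =>
    Finset.prod_nonneg fun i _ => mul_nonneg (hP.1 (x i)) (Real.exp_pos _).le)
  rw [Finset.prod_mul_distrib, ← Real.exp_sum, ← Finset.mul_sum]
  rcases (powDist_nonneg hP.1 n x).eq_or_lt with h | h
  · rw [← h]
    exact mul_nonneg (powDist_nonneg hP.1 n x) (Real.exp_pos _).le
  · exact le_mul_of_one_le_right h.le (Real.one_le_exp (mul_nonneg ht.le (hs n x hx h)))

theorem log_powDist {X : Type*} {P : X → ℝ} {n : ℕ} {x : Fin n → X} (h : 0 < powDist P n x) :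
    Real.log (powDist P n x) = ∑ i, Real.log (P (x i)) :=
  Real.log_prod fun i _ hi => h.ne' (Finset.prod_eq_zero (Finset.mem_univ i) hi)

theorem sum_mul_log {X : Type*} [Fintype X] (P : X → ℝ) :
    ∑ x, P x * Real.log (P x) = -entropy P := by
  simp [entropy, Real.negMulLog]

theorem tendsto_sum_powDist_lt {X : Type*} [Fintype X] {P : X → ℝ}
    (hP : P ∈ stdSimplex ℝ X) {r : ℝ} (hr : entropy P < r) :
    Tendsto (fun n : ℕ => ∑ x with powDist P n x < Real.exp (-(n * r)), powDist P n x)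
      atTop (𝓝 0) := by
  refine tendsto_sum_powDist_of_neg_mean hP (g := fun x => -Real.log (P x) - r) ?_ _ ?_
  · have : ∑ x, P x * (-Real.log (P x) - r) =
        -(∑ x, P x * Real.log (P x)) - (∑ x, P x) * r := by
      rw [Finset.sum_mul, ← Finset.sum_neg_distrib, ← Finset.sum_sub_distrib]
      exact Finset.sum_congr rfl fun x _ => by ring
    rw [this, sum_mul_log, hP.2]
    linarith
  · intro n x hx h
    have hlt := (Real.log_lt_iff_lt_exp h).2 (Finset.mem_filter.1 hx).2
    rw [log_powDist h] at hlt
    simp only [Finset.sum_sub_distrib, Finset.sum_neg_distrib, Finset.sum_const,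
      Finset.card_univ, Fintype.card_fin, nsmul_eq_mul]
    linarith

theorem tendsto_sum_powDist_gt {X : Type*} [Fintype X] {P : X → ℝ}
    (hP : P ∈ stdSimplex ℝ X) {r : ℝ} (hr : r < entropy P) :
    Tendsto (fun n : ℕ => ∑ x with Real.exp (-(n * r)) < powDist P n x, powDist P n x)
      atTop (𝓝 0) := by
  refine tendsto_sum_powDist_of_neg_mean hP (g := fun x => Real.log (P x) + r) ?_ _ ?_
  · have : ∑ x, P x * (Real.log (P x) + r) =
        ∑ x, P x * Real.log (P x) + (∑ x, P x) * r := by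
      rw [Finset.sum_mul, ← Finset.sum_add_distrib]
      exact Finset.sum_congr rfl fun x _ => by ring
    rw [this, sum_mul_log, hP.2]
    linarith
  · intro n x hx h
    have hlt := (Real.lt_log_iff_exp_lt h).2 (Finset.mem_filter.1 hx).2
    rw [log_powDist h] at hlt
    simp only [Finset.sum_add_distrib, Finset.sum_const,
      Finset.card_univ, Fintype.card_fin, nsmul_eq_mul]
    linarith

/-! ### Codes -/

theorem unif_mem_stdSimplex {N : ℕ} (hN : 0 < N) : unif N ∈ stdSimplex ℝ (Fin N) :=
  ⟨fun _ => by unfold unif; positivity, by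
    have : (N : ℝ) ≠ 0 := by positivity
    simp [unif, this]⟩

theorem numMsg_pos {R : ℝ} (hR : 0 ≤ R) (n : ℕ) : 0 < numMsg R n :=
  Nat.floor_pos.2 (Real.one_le_exp (by positivity))

theorem le_guessProb {X : Type*} [Fintype X] {N : ℕ} (K : Fin N → X → ℝ) (f : Fin N → X) :
    ∑ m, unif N m * K m (f m) ≤ guessProb K :=
  le_ciSup (f := fun f : Fin N → X => ∑ m, unif N m * K m (f m)) (Set.finite_range _).bddAbove f

theorem guessProb_le_one {X : Type*} [Fintype X] [Nonempty X] {N : ℕ} {K : Fin N → X → ℝ}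
    (hN : 0 < N) (hK : IsChannel K) : guessProb K ≤ 1 := by
  refine ciSup_le fun f => ?_
  rw [← (unif_mem_stdSimplex hN).2]
  refine Finset.sum_le_sum fun m _ => mul_le_of_le_one_right ((unif_mem_stdSimplex hN).1 m) ?_
  rw [← (hK m).2]
  exact Finset.single_le_sum (fun x _ => (hK m).1 x) (Finset.mem_univ _)

/-- Any distribution is simulated exactly from `N` uniform messages by a code that is
deterministic except for the loss due to rounding down. -/
theorem exists_code {X : Type*} [Fintype X] {P : X → ℝ} (hP : P ∈ stdSimplex ℝ X) {N : ℕ}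
    (hN : 0 < N) : ∃ K : Fin N → X → ℝ, IsChannel K ∧ output K (unif N) = P ∧
      ∑ x, (⌊N * P x⌋₊ : ℝ) / N ≤ guessProb K := by
  classical
  have hN' : (0 : ℝ) < N := by exact_mod_cast hN
  obtain ⟨x₀⟩ : Nonempty X := by
    by_contra h
    rw [not_nonempty_iff] at h
    simpa using hP.2
  set k : X → ℕ := fun x => ⌊N * P x⌋₊ with hk
  have hkle : ∀ x, (k x : ℝ) ≤ N * P x := fun x => Nat.floor_le (mul_nonneg hN'.le (hP.1 x))
  have hksum : ∑ x, k x ≤ N := by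
    have : ∑ x, (k x : ℝ) ≤ N := by
      refine (Finset.sum_le_sum fun x _ => hkle x).trans ?_
      rw [← Finset.mul_sum, hP.2, mul_one]
    exact_mod_cast this
  -- Disjoint blocks of `k x` messages, each sent deterministically to its letter `x`.
  obtain ⟨e⟩ : Nonempty ((Σ x, Fin (k x)) ↪ Fin N) :=
    Function.Embedding.nonempty_of_card_le (by simpa using hksum)
  -- the rounding residue and its total mass
  set r : X → ℝ := fun x => N * P x - k x with hr
  have hr0 : ∀ x, 0 ≤ r x := fun x => sub_nonneg.2 (hkle x)
  set D : ℝ := ∑ x, r x with hD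
  have hDeq : D = N - ∑ x, (k x : ℝ) := by
    rw [hD, hr, Finset.sum_sub_distrib, ← Finset.mul_sum, hP.2, mul_one]
  set S : Finset (Fin N) := Finset.univ.map e with hS
  -- The leftover messages are exactly as many as the residual mass `D`, so drawing from `r / D` on
  -- each restores `N * P x`.
  have hScard : ((Sᶜ.card : ℕ) : ℝ) = D := by
    rw [Finset.card_compl, Nat.cast_sub (Finset.card_le_univ _), hDeq]
    simp [hS]
  let K : Fin N → X → ℝ := fun m x =>
    if h : ∃ a, e a = m then (if h.choose.1 = x then 1 else 0) else r x / D
  have hKe : ∀ a x, K (e a) x = if a.1 = x then 1 else 0 := by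
    intro a x
    have h : ∃ b, e b = e a := ⟨a, rfl⟩
    have hb : h.choose = a := e.injective h.choose_spec
    simp only [K, dif_pos h, hb]
  have hKc : ∀ m ∈ Sᶜ, ∀ x, K m x = r x / D := by
    intro m hm x
    have : ¬ ∃ a, e a = m := by simpa [hS] using hm
    simp only [K, dif_neg this]
  have hDpos : ∀ m ∈ Sᶜ, 0 < D := fun m hm => by
    rw [← hScard]
    exact_mod_cast Finset.card_pos.2 ⟨m, hm⟩
  have hcases : ∀ m, (∃ a, e a = m) ∨ m ∈ Sᶜ := fun m => by
    by_cases h : ∃ a, e a = m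
    · exact Or.inl h
    · exact Or.inr (by simpa [hS] using h)
  have hKch : IsChannel K := by
    intro m
    rcases hcases m with ⟨a, rfl⟩ | hm
    · refine ⟨fun x => ?_, ?_⟩
      · rw [hKe]; split_ifs <;> norm_num
      · simp [hKe]
    · refine ⟨fun x => ?_, ?_⟩
      · rw [hKc m hm]; exact div_nonneg (hr0 x) (hDpos m hm).le
      · rw [Finset.sum_congr rfl fun x _ => hKc m hm x, ← Finset.sum_div,
          div_self (hDpos m hm).ne']
  refine ⟨K, hKch, ?_, ?_⟩
  · funext x
    have h1 : ∑ m ∈ S, K m x = k x := by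
      rw [hS, Finset.sum_map]
      simp only [hKe]
      rw [Fintype.sum_sigma, Fintype.sum_eq_single x fun x' hx' => by simp [hx']]
      simp
    have h2 : ∑ m ∈ Sᶜ, K m x = r x := by
      rw [Finset.sum_congr rfl fun m hm => hKc m hm x, Finset.sum_const, nsmul_eq_mul, hScard]
      rcases eq_or_ne D 0 with h | h
      · rw [h, zero_mul]
        exact ((Finset.sum_eq_zero_iff_of_nonneg fun x _ => hr0 x).1 h x (Finset.mem_univ x)).symm
      · exact mul_div_cancel₀ _ h
    simp only [output, unif]
    rw [← Finset.sum_mul, ← Finset.sum_add_sum_compl S, h1, h2, hr]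
    field_simp
    ring
  · let f : Fin N → X := fun m => if h : ∃ a, e a = m then h.choose.1 else x₀
    have hf : ∀ a, f (e a) = a.1 := by
      intro a
      have h : ∃ b, e b = e a := ⟨a, rfl⟩
      have hb : h.choose = a := e.injective h.choose_spec
      simp only [f, dif_pos h, hb]
    refine le_trans ?_ (le_guessProb K f)
    refine le_trans (le_of_eq ?_) (Finset.sum_le_univ_sum_of_nonneg (s := S) fun m =>
      mul_nonneg ((unif_mem_stdSimplex hN).1 m) ((hKch m).1 _))
    rw [hS, Finset.sum_map]
    simp only [hKe, hf, if_true, mul_one, unif]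
    rw [← Finset.sum_div, Finset.sum_const, nsmul_eq_mul]
    simp [div_eq_mul_inv, hk]

/-- Rounding costs less than `1/N` per letter of `s`; the other letters are dropped. -/
theorem sum_sub_card_div_le {X : Type*} [Fintype X] {P : X → ℝ} {N : ℕ}
    (hN : 0 < N) (s : Finset X) :
    ∑ x ∈ s, P x - s.card / N ≤ ∑ x, (⌊N * P x⌋₊ : ℝ) / N := by
  have hN' : (0 : ℝ) < N := by exact_mod_cast hN
  refine le_trans ?_ (Finset.sum_le_univ_sum_of_nonneg (s := s) fun x => by positivity)
  have : (s.card : ℝ) / N = ∑ x ∈ s, 1 / (N : ℝ) := by simp [div_eq_mul_inv]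
  rw [this, ← Finset.sum_sub_distrib]
  refine Finset.sum_le_sum fun x _ => ?_
  rw [sub_le_iff_le_add, ← add_div, le_div_iff₀ hN', mul_comm]
  exact (Nat.lt_floor_add_one _).le

theorem card_mul_le_one {X : Type*} [Fintype X] {P : X → ℝ} (hP : P ∈ stdSimplex ℝ X) {c : ℝ}
    {s : Finset X} (hs : ∀ x ∈ s, c ≤ P x) : s.card * c ≤ 1 := by
  rw [← hP.2, ← nsmul_eq_mul]
  exact (Finset.card_nsmul_le_sum s _ _ hs).trans (Finset.sum_le_univ_sum_of_nonneg hP.1)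

theorem exp_div_numMsg_le {R : ℝ} (hR : 0 ≤ R) (n : ℕ) :
    Real.exp (n * R) / numMsg R n ≤ 2 := by
  have h0 : (1 : ℝ) ≤ numMsg R n := by exact_mod_cast numMsg_pos hR n
  rw [div_le_iff₀ (by linarith)]
  have : Real.exp (n * R) < numMsg R n + 1 := Nat.lt_floor_add_one _
  linarith

theorem tendsto_exp_neg_nat_mul {c : ℝ} (hc : 0 < c) :
    Tendsto (fun n : ℕ => Real.exp (-(n * c))) atTop (𝓝 0) :=
  Real.tendsto_exp_neg_atTop_nhds_zero.comp
    (tendsto_natCast_atTop_atTop.atTop_mul_const hc)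

theorem entropy_nonneg {X : Type*} [Fintype X] {P : X → ℝ} (hP : P ∈ stdSimplex ℝ X) :
    0 ≤ entropy P := by
  refine Finset.sum_nonneg fun x _ => Real.negMulLog_nonneg (hP.1 x) ?_
  rw [← hP.2]
  exact Finset.single_le_sum (fun x _ => hP.1 x) (Finset.mem_univ x)

theorem achievable_of_entropy_lt {X Y : Type*} [Fintype X] {W : X → Y → ℝ}
    {P : X → ℝ} {Q : Y → ℝ} (hP : P ∈ inputs W Q) {R : ℝ} (hR : entropy P < R) :
    Achievable W Q R := by
  have hR0 : 0 ≤ R := (entropy_nonneg hP.1).trans hR.le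
  have : Nonempty X := by
    by_contra h
    rw [not_nonempty_iff] at h
    simpa using hP.1.2
  have hpow := powDist_mem_stdSimplex hP.1
  choose K hK hout hguess using fun n => exists_code (hpow n) (numMsg_pos hR0 n)
  refine ⟨hR0, K, hK, fun n => by rw [hout, output_powDist hP.2], ?_⟩
  -- At most `e^{nr}` strings have probability at least `e^{-nr}`, so their rounding loss is at most
  -- `e^{nr}/N ≤ 2e^{-n(R-r)}`.
  obtain ⟨r, hr1, hr2⟩ := exists_between hR
  have hlim : Tendsto (fun n : ℕ => 1 - ∑ x with powDist P n x < Real.exp (-(n * r)), powDist P n x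
      - 2 * Real.exp (-(n * (R - r)))) atTop (𝓝 1) := by
    simpa using ((tendsto_sum_powDist_lt hP.1 hr1).const_sub 1).sub
      ((tendsto_exp_neg_nat_mul (sub_pos.2 hr2)).const_mul 2)
  refine tendsto_of_tendsto_of_tendsto_of_le_of_le hlim tendsto_const_nhds (fun n => ?_)
    fun n => guessProb_le_one (numMsg_pos hR0 n) (hK n)
  refine le_trans ?_ (hguess n)
  refine le_trans ?_ (sum_sub_card_div_le (numMsg_pos hR0 n)
    (Finset.univ.filter fun x => ¬ powDist P n x < Real.exp (-(n * r))))
  refine sub_le_sub (le_of_eq ?_) ?_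
  · rw [sub_eq_iff_eq_add', ← (hpow n).2]
    exact (Finset.sum_filter_add_sum_filter_not _ _ _).symm
  · set s := Finset.univ.filter fun x => ¬ powDist P n x < Real.exp (-(n * r)) with hs
    have hcard := card_mul_le_one (hpow n) (s := s) (c := Real.exp (-(n * r)))
      fun x hx => not_lt.1 (Finset.mem_filter.1 hx).2
    rw [Real.exp_neg, ← div_eq_mul_inv, div_le_one (Real.exp_pos _)] at hcard
    calc (s.card : ℝ) / numMsg R n ≤ Real.exp (n * r) / numMsg R n := by gcongr
      _ = Real.exp (n * R) / numMsg R n * Real.exp (-(n * (R - r))) := by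
        rw [div_mul_eq_mul_div, ← Real.exp_add]
        ring_nf
      _ ≤ 2 * Real.exp (-(n * (R - r))) := by
        gcongr
        exact exp_div_numMsg_le hR0 n

/-! ### Converse and the rate formula -/

/-- A guess takes at most `N` values, so it is right with probability at most `N c` outside of the
event that the guessed letter has probability more than `c`. -/
theorem guessProb_le {X : Type*} [Fintype X] [Nonempty X] {N : ℕ} {K : Fin N → X → ℝ}
    (hK : IsChannel K) {P : X → ℝ} (hP : output K (unif N) = P) {c : ℝ} (hc : 0 ≤ c) :
    guessProb K ≤ N * c + ∑ x with c < P x, P x := by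
  classical
  have hterm : ∀ m x, 0 ≤ unif N m * K m x := fun m x =>
    mul_nonneg (by unfold unif; positivity) ((hK m).1 x)
  have hP' : ∀ x, P x = ∑ m, unif N m * K m x := fun x => by
    rw [← hP]; exact Finset.sum_congr rfl fun m _ => mul_comm _ _
  have hP0 : ∀ x, 0 ≤ P x := fun x => hP' x ▸ Finset.sum_nonneg fun m _ => hterm m x
  refine ciSup_le fun f => ?_
  calc ∑ m, unif N m * K m (f m)
      = ∑ x ∈ Finset.univ.image f, ∑ m with f m = x, unif N m * K m (f m) :=
        (Finset.sum_fiberwise_of_maps_to (fun m _ => Finset.mem_image_of_mem f (Finset.mem_univ m))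
          _).symm
    _ ≤ ∑ x ∈ Finset.univ.image f, P x := by
        refine Finset.sum_le_sum fun x _ => ?_
        rw [hP', Finset.sum_congr rfl fun m hm => by rw [(Finset.mem_filter.1 hm).2]]
        exact Finset.sum_le_univ_sum_of_nonneg fun m => hterm m x
    _ = ∑ x ∈ Finset.univ.image f with ¬ c < P x, P x
          + ∑ x ∈ Finset.univ.image f with c < P x, P x := by
        rw [add_comm, Finset.sum_filter_add_sum_filter_not]
    _ ≤ N * c + ∑ x with c < P x, P x := by
        refine add_le_add ?_ (Finset.sum_le_sum_of_subset_of_nonneg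
          (Finset.filter_subset_filter _ (Finset.subset_univ _)) fun x _ _ => hP0 x)
        refine (Finset.sum_le_card_nsmul _ _ c fun x hx =>
          not_lt.1 (Finset.mem_filter.1 hx).2).trans ?_
        rw [nsmul_eq_mul]
        have : (Finset.filter (fun x => ¬ c < P x) (Finset.univ.image f)).card ≤ N :=
          (Finset.card_filter_le _ _).trans (Finset.card_image_le.trans (by simp))
        gcongr

theorem entropy_le_of_achievable {X Y : Type*} [Fintype X] [Fintype Y] {W : X → Y → ℝ}
    (hW : IsChannel W) {P : X → ℝ} {Q : Y → ℝ} (hQ : Q ∈ stdSimplex ℝ Y)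
    (huniq : ∀ P' ∈ inputs W Q, P' = P) (hP : P ∈ stdSimplex ℝ X) {R : ℝ}
    (hR : Achievable W Q R) : entropy P ≤ R := by
  by_contra! hlt
  obtain ⟨hR0, K, hK, hout, hguess⟩ := hR
  have : Nonempty X := by
    by_contra h
    rw [not_nonempty_iff] at h
    simpa using hP.2
  obtain ⟨r, hr1, hr2⟩ := exists_between hlt
  -- Non-redundancy enters here: it pins down the input law, so the guessing bound with `c =
  -- e^{-nr}` tends to 0 rather than 1.
  have hKP : ∀ n, output (K n) (unif _) = powDist P n := fun n =>
    eq_powDist_of_output_eq hW huniq hQ n _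
      ⟨output_mem_stdSimplex (hK n) (unif_mem_stdSimplex (numMsg_pos hR0 n)), hout n⟩
  have hlim : Tendsto (fun n : ℕ => Real.exp (-(n * (r - R))) +
      ∑ x with Real.exp (-(n * r)) < powDist P n x, powDist P n x) atTop (𝓝 0) := by
    simpa using (tendsto_exp_neg_nat_mul (sub_pos.2 hr1)).add (tendsto_sum_powDist_gt hP hr2)
  refine absurd (le_of_tendsto_of_tendsto' hguess hlim fun n => ?_) (by norm_num)
  refine (guessProb_le (hK n) (hKP n) (Real.exp_pos (-(n * r))).le).trans ?_
  gcongr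
  have h : (numMsg R n : ℝ) ≤ Real.exp (n * R) := Nat.floor_le (Real.exp_pos _).le
  calc (numMsg R n : ℝ) * Real.exp (-(n * r)) ≤ Real.exp (n * R) * Real.exp (-(n * r)) := by gcongr
    _ = Real.exp (-(n * (r - R))) := by
      rw [← Real.exp_add]
      ring_nf

theorem exactRate_eq_entropy {X Y : Type*} [Fintype X] [Fintype Y] {W : X → Y → ℝ}
    (hW : IsChannel W) {P : X → ℝ} {Q : Y → ℝ} (hQ : Q ∈ stdSimplex ℝ Y)
    (huniq : ∀ P' ∈ inputs W Q, P' = P) (hP : P ∈ inputs W Q) :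
    exactRate W Q = (entropy P : EReal) := by
  -- The entropy itself need not be shown achievable; every larger real rate is.
  refine le_antisymm (EReal.le_of_forall_lt_iff_le.1 fun z hz => ?_)
    (le_iInf₂ fun R hR => EReal.coe_le_coe_iff.2 (entropy_le_of_achievable hW hQ huniq hP.1 hR))
  exact iInf₂_le z (achievable_of_entropy_lt hP (EReal.coe_lt_coe_iff.1 hz))

theorem minEntropy_eq_entropy {X Y : Type*} [Fintype X] {W : X → Y → ℝ} {P : X → ℝ} {Q : Y → ℝ}
    (huniq : ∀ P' ∈ inputs W Q, P' = P) (hP : P ∈ inputs W Q) :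
    minEntropy W Q = (entropy P : EReal) :=
  le_antisymm (iInf₂_le P hP) (le_iInf₂ fun P' hP' => by rw [huniq P' hP'])

end ExactResolvability

theorem mainTheorem9 :
    -- the rate of a non-redundant channel
    (∀ {X Y : Type*} [Fintype X] [Fintype Y] (W : X → Y → ℝ) (PY : Y → ℝ) (PX : X → ℝ),
      ExactResolvability.IsChannel W → PY ∈ stdSimplex ℝ Y →
      ExactResolvability.IsNonRedundant W PY → PX ∈ ExactResolvability.inputs W PY →
        ExactResolvability.exactRate W PY = ExactResolvability.minEntropy W PY ∧
        ExactResolvability.minEntropy W PY = (ExactResolvability.entropy PX : EReal)) ∧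
    -- full-rank channels are non-redundant for each output distribution that they can produce
    (∀ {X Y : Type*} [Fintype X] [Fintype Y] (W : X → Y → ℝ) (PY : Y → ℝ),
      ExactResolvability.IsChannel W → ExactResolvability.IsFullRank W →
      (ExactResolvability.inputs W PY).Nonempty → ExactResolvability.IsNonRedundant W PY) ∧
    -- additive channels are full-rank, hence non-redundant as well
    (∀ {G : Type*} [AddCommGroup G] [IsAddTorsionFree G] {A B : Finset G} (W : A → B → ℝ),
      ExactResolvability.IsChannel W → ExactResolvability.IsAdditive W →
      ExactResolvability.IsFullRank W ∧ ∀ PY : B → ℝ,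
        (ExactResolvability.inputs W PY).Nonempty → ExactResolvability.IsNonRedundant W PY) := by
  refine ⟨fun W PY PX hW hPY hnr hPX => ?_, fun W PY _ hfull hne => hfull.isNonRedundant hne,
    fun W hW hadd => ⟨hadd.isFullRank hW, fun PY hne => (hadd.isFullRank hW).isNonRedundant hne⟩⟩
  have huniq := fun P' hP' => hnr.unique (y₁ := P') hP' hPX
  have hmin := ExactResolvability.minEntropy_eq_entropy huniq hPX
  exact ⟨(ExactResolvability.exactRate_eq_entropy hW hPY huniq hPX).trans hmin.symm, hmin⟩
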